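/- Let $n\ge 0$ and let $S=S(\mathbf G,\mathbf\Sigma)$ be a constrained switching system: $\mathbf G=(V,E)$ is a finite, strongly connected directed graph whose edges $(v,w,\sigma)\in E$ carry labels $\sigma$ from a finite set $\Lambda$, and $\mathbf\Sigma=\{A_\sigma\}_{\sigma\in\Lambda}\subset\mathbb R^{n\times n}$. A word $\sigma(0),\dots,\sigma(t-1)$ is accepted if it is the sequence of labels of some path of $\mathbf G$. The constrained joint spectral radius of $S$ is $$\hat\rho(S)=\lim_{t\to\infty}\max\bigl\{\|A_{\sigma(t-1)}\cdots A_{\sigma(0)}\|^{1/t}:\ \sigma(0),\dots,\sigma(t-1)\text{ accepted by }\mathbf G\bigr\},$$ with $\|\cdot\|$ induced by the Euclidean norm (and the maximum over the empty set read as $0$). The LMI estimate $\gamma_*(S)$ is the infimum of all $\gamma\ge 0$ for which there are symmetric positive definite matrices $Q_v$, $v\in V$, with $-A_\sigma^\top Q_wA_\sigma+\gamma^2Q_v\succeq 0$ for every $(v,w,\sigma)\in E$. For an integer $d\ge 1$, the $d$-lift (Veronese lift) $x^{[d]}\in\mathbb R^{C(n+d-1,d)}$ of $x\in\mathbb R^n$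 is the vector with coordinates $\sqrt{d!/(\alpha_1!\cdots\alpha_n!)}\;x^\alpha$, $|\alpha|=d$, where $C(k,\ell)$ is the binomial coefficient; $A^{[d]}$ is the matrix with $A^{[d]}x^{[d]}=(Ax)^{[d]}$ for all $x\in\mathbb R^n$; and $S^{[d]}$ is the system on the same graph $\mathbf G$ with the matrices $A_\sigma^{[d]}$ in place of $A_\sigma$. **Theorem.** The limit defining $\hat\rho(S)$ exists, and for every integer $d\ge1$ $$\hat\rho(S)\ \le\ \gamma_*(S^{[d]})^{1/d}\ \le\ C(n+d-1,d)^{1/(2d)}\,\hat\rho(S).$$ Consequently, for every $r>0$ there is a $d_0$ depending only on $n$ and $r$ such that, for all $d\ge d_0$ and all such systems $S$ on $\mathbb R^n$, $\hat\rho(S)\le\gamma_*(S^{[d]})^{1/d}\le(1+r)\hat\rho(S)$. -/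

import Mathlib

open Filter Topology

universe u v

/-- A (discrete-time) constrained switching system: a directed graph on the node set `V` whose edges
`(v, w, σ)` carry labels `σ : Λ`, together with one real square matrix `A σ` for every label. The
matrices act on `ℝ^ι`. -/
structure SwitchingSystem (ι : Type*) (V : Type u) (Λ : Type v) where
  /-- The labelled edges: `(v, w, σ)` is an edge from `v` to `w` with label `σ`. -/
  edges : Set (V × V × Λ)
  /-- The matrix of each mode. -/
  A : Λ → Matrix ι ι ℝ

namespace SwitchingSystem

section Basic

variable {ι : Type*} {V : Type u} {Λ : Type v} (S : SwitchingSystem ι V Λ)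

/-- `S.IsPath v l w`: there is a path in the graph of `S` from `v` to `w` (of length `l.length`)
whose successive labels are `l`, the first label of the path being the head of `l`. -/
inductive IsPath : V → List Λ → V → Prop
  | nil (v : V) : IsPath v [] v
  | cons {v w z : V} {σ : Λ} {l : List Λ} (he : (v, w, σ) ∈ S.edges) (hp : IsPath w l z) :
      IsPath v (σ :: l) z

/-- The word `l` of labels is accepted by the graph: it is carried by some path, with no
restriction on the first and last nodes. -/
def Accepts (l : List Λ) : Prop := ∃ v w, S.IsPath v l w

/-- Any node can be reached from any node. -/
def StronglyConnected : Prop := ∀ v w, ∃ l, S.IsPath v l w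

variable [Fintype ι] [DecidableEq ι]

/-- The product `A σ(t-1) * ⋯ * A σ(0)` along the word `[σ(0), …, σ(t-1)]`. -/
def wordProd : List Λ → Matrix ι ι ℝ
  | [] => 1
  | σ :: l => wordProd l * S.A σ

/-- The maximum of `‖A σ(t-1) * ⋯ * A σ(0)‖ ^ (1/t)` over the accepted words of length `t`, with the
matrix norm induced by the Euclidean norm (the value is `0` if no word of length `t` is accepted). -/
noncomputable def growth (t : ℕ) : ℝ :=
  sSup {a : ℝ | ∃ l : List Λ, l.length = t ∧ S.Accepts l ∧
    a = ‖Matrix.toEuclideanCLM (𝕜 := ℝ) (S.wordProd l)‖ ^ (1 / (t : ℝ))}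

/-- The constrained joint spectral radius. -/
noncomputable def cjsr : ℝ := limUnder atTop S.growth

/-- `γ ≥ 0` is feasible if there are positive definite matrices `Q v`, one for each node, with
`γ² Q v - (A σ)ᵀ (Q w) (A σ) ⪰ 0` for every edge `(v, w, σ)`. -/
def LMIFeasible (γ : ℝ) : Prop :=
  0 ≤ γ ∧ ∃ Q : V → Matrix ι ι ℝ, (∀ v, (Q v).PosDef) ∧
    ∀ v w σ, (v, w, σ) ∈ S.edges →
      (-((S.A σ).transpose * Q w * S.A σ) + γ ^ 2 • Q v).PosSemidef

/-- The optimal value of the LMI program. -/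
noncomputable def lmiValue : ℝ := sInf {γ : ℝ | S.LMIFeasible γ}

theorem exists_lmiFeasible [Finite Λ] : ∃ γ, S.LMIFeasible γ := by
  classical
  cases nonempty_fintype Λ
  let N : Λ → ℝ := fun σ => ‖Matrix.toEuclideanCLM (𝕜 := ℝ) (S.A σ)‖
  have hN : ∀ σ, N σ ≤ ∑ τ, N τ := fun σ =>
    Finset.single_le_sum (f := N) (fun _ _ => norm_nonneg _) (Finset.mem_univ σ)
  have h0 : 0 ≤ ∑ τ, N τ := Finset.sum_nonneg fun _ _ => norm_nonneg _
  refine ⟨∑ τ, N τ, h0, fun _ => 1, fun _ => Matrix.PosDef.one, fun v w σ _ => ?_⟩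
  refine Matrix.PosSemidef.of_dotProduct_mulVec_nonneg ?_ fun x => ?_
  · simp [Matrix.IsHermitian, Matrix.conjTranspose_eq_transpose_of_trivial]
  · have h1 := (Matrix.toEuclideanCLM (𝕜 := ℝ) (S.A σ)).le_opNorm (WithLp.toLp 2 x)
    have h2 : ‖Matrix.toEuclideanCLM (𝕜 := ℝ) (S.A σ) (WithLp.toLp 2 x)‖ ≤
        (∑ τ, N τ) * ‖WithLp.toLp 2 x‖ :=
      h1.trans (mul_le_mul_of_nonneg_right (hN σ) (norm_nonneg _))
    have h3 := pow_le_pow_left₀ (norm_nonneg _) h2 2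
    rw [mul_pow, EuclideanSpace.norm_sq_eq, EuclideanSpace.norm_sq_eq] at h3
    have h4 : dotProduct x (((S.A σ).transpose * S.A σ).mulVec x) =
        dotProduct ((S.A σ).mulVec x) ((S.A σ).mulVec x) := by
      rw [← Matrix.mulVec_mulVec, Matrix.dotProduct_mulVec, Matrix.vecMul_transpose]
    simp only [star_trivial, Matrix.mul_one, Matrix.add_mulVec, Matrix.neg_mulVec,
      Matrix.smul_mulVec, Matrix.one_mulVec, dotProduct_add, dotProduct_neg, h4, dotProduct_smul,
      smul_eq_mul]
    simp only [Real.norm_eq_abs, sq_abs, Matrix.ofLp_toEuclideanCLM] at h3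
    simp only [dotProduct, ← sq]
    linarith

end Basic

end SwitchingSystem

section Veronese

variable {n : ℕ}

/-- The `d`-lift `x^[d]` of a vector: its coordinates are indexed by the monomials of degree `d` in
`n` variables (multisets of size `d`), the coordinate of `x^α` being `√(d!/α!) x^α`
(`Multiset.countPerms` is the multinomial coefficient `d!/α! = d!/∏ᵢ αᵢ!`). With this scaling
`|x^[d]| = |x|^d` for the Euclidean norms. -/
noncomputable def veroneseVec (d : ℕ) (x : Fin n → ℝ) : Sym (Fin n) d → ℝ := fun s =>
  √((s : Multiset (Fin n)).countPerms : ℝ) * ((s : Multiset (Fin n)).map x).prod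

/-- The `d`-lift `A^[d]` of a matrix: the `(s, t)` entry is `√(d!/s!) / √(d!/t!)`
times the coefficient of the monomial `x^t` in the polynomial `(A x)^s`. It is the matrix with
`A^[d] x^[d] = (A x)^[d]` for all `x`. -/
noncomputable def veroneseMatrix (d : ℕ) (A : Matrix (Fin n) (Fin n) ℝ) :
    Matrix (Sym (Fin n) d) (Sym (Fin n) d) ℝ := Matrix.of fun s t =>
  √((s : Multiset (Fin n)).countPerms : ℝ) / √((t : Multiset (Fin n)).countPerms : ℝ) *
    MvPolynomial.coeff (Multiset.toFinsupp (t : Multiset (Fin n)))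
      ((s : Multiset (Fin n)).map
        fun i => ∑ j, MvPolynomial.C (A i j) * (MvPolynomial.X j : MvPolynomial (Fin n) ℝ)).prod

theorem sum_sq_veroneseVec (d : ℕ) (x : Fin n → ℝ) :
    ∑ s, veroneseVec d x s ^ 2 = (∑ i, x i ^ 2) ^ d := by
  have h := Finset.sum_pow (s := Finset.univ) (fun i => x i ^ 2) d
  rw [h, Finset.sym_univ]
  refine Finset.sum_congr rfl fun s _ => ?_
  rw [veroneseVec, mul_pow, Real.sq_sqrt (Nat.cast_nonneg _), Multiset.prod_map_pow]
  rfl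

theorem veroneseMatrix_mulVec (d : ℕ) (A : Matrix (Fin n) (Fin n) ℝ) (x : Fin n → ℝ) :
    (veroneseMatrix d A).mulVec (veroneseVec d x) = veroneseVec d (A.mulVec x) := by
  have hpos : ∀ m : Multiset (Fin n), 0 < √(m.countPerms : ℝ) := fun m =>
    Real.sqrt_pos.2 (Nat.cast_pos.2 (Nat.multinomial_pos _ _))
  funext s
  set P : MvPolynomial (Fin n) ℝ := ((s : Multiset (Fin n)).map
    fun i => ∑ j, MvPolynomial.C (A i j) * (MvPolynomial.X j : MvPolynomial (Fin n) ℝ)).prod with hP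
  have hom : ∀ m : Multiset (Fin n), ((m.map fun i => ∑ j, MvPolynomial.C (A i j) *
      (MvPolynomial.X j : MvPolynomial (Fin n) ℝ)).prod).IsHomogeneous m.card := by
    intro m
    induction m using Multiset.induction_on with
    | empty => simpa using MvPolynomial.isHomogeneous_one (Fin n) ℝ
    | cons a m ih =>
      rw [Multiset.map_cons, Multiset.prod_cons, Multiset.card_cons, add_comm]
      refine MvPolynomial.IsHomogeneous.mul ?_ ih
      exact MvPolynomial.IsHomogeneous.sum _ _ _ fun j _ =>
        (MvPolynomial.isHomogeneous_C_mul_X _ _)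
  have hPh : P.IsHomogeneous d := by simpa [hP] using hom (s : Multiset (Fin n))
  have heval : MvPolynomial.eval x P = ((s : Multiset (Fin n)).map (A.mulVec x)).prod := by
    rw [hP, map_multiset_prod, Multiset.map_map]
    simp [Matrix.mulVec, dotProduct]
    rfl
  have hsum : MvPolynomial.eval x P = ∑ t : Sym (Fin n) d,
      MvPolynomial.coeff (Multiset.toFinsupp (t : Multiset (Fin n))) P *
        ((t : Multiset (Fin n)).map x).prod := by
    have hinj : Function.Injective
        fun t : Sym (Fin n) d => Multiset.toFinsupp (t : Multiset (Fin n)) := fun a b hab =>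
      Subtype.ext (Multiset.toFinsupp.injective hab)
    have hsub : P.support ⊆ Finset.univ.image
        fun t : Sym (Fin n) d => Multiset.toFinsupp (t : Multiset (Fin n)) := by
      intro m hm
      have hd := hPh (MvPolynomial.mem_support_iff.1 hm)
      refine Finset.mem_image.2 ⟨⟨Finsupp.toMultiset m, ?_⟩, Finset.mem_univ _, ?_⟩
      · rw [Finsupp.card_toMultiset, ← hd]
        simp [Finsupp.weight_apply, Finsupp.sum]
      · exact Finsupp.toMultiset_toFinsupp m
    rw [MvPolynomial.eval_eq', Finset.sum_subset hsub, Finset.sum_image fun a _ b _ h => hinj h]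
    · refine Finset.sum_congr rfl fun t _ => ?_
      rw [Finset.prod_multiset_map_count]
      congr 1
      symm
      refine Finset.prod_subset (Finset.subset_univ _) fun i _ hi => ?_
      rw [Multiset.count_eq_zero_of_notMem (by simpa using hi), pow_zero]
    · intro m _ hm
      rw [MvPolynomial.notMem_support_iff.1 hm, zero_mul]
  rw [veroneseVec, ← heval, hsum, Finset.mul_sum]
  refine Finset.sum_congr rfl fun t _ => ?_
  simp only [veroneseMatrix, Matrix.of_apply, veroneseVec, ← hP]
  have := (hpos (t : Multiset (Fin n))).ne'
  field_simp

end Veronese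

/-- The system on the same graph with all matrices replaced by their `d`-lifts. -/
noncomputable def SwitchingSystem.lift {n : ℕ} {V : Type u} {Λ : Type v}
    (S : SwitchingSystem (Fin n) V Λ) (d : ℕ) : SwitchingSystem (Sym (Fin n) d) V Λ where
  edges := S.edges
  A σ := veroneseMatrix d (S.A σ)

/-!
The argument combines an estimate for an arbitrary constrained switching system `T` on `ℝ^ι`, with
`N = card ι`, and an identity for lifts:

* `cjsr T ≤ lmiValue T ≤ √N * cjsr T` (`SwitchingSystem.cjsr_le_lmiValue`,
  `SwitchingSystem.lmiValue_le_sqrt_card_mul_cjsr`);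
* `cjsr (S.lift d) = cjsr S ^ d` (`SwitchingSystem.lift_cjsr`).

Applying the first to `T = S.lift d`, whose dimension is `C(n+d-1, d)`, and taking `d`-th roots
gives the bounds; the factor `C(n+d-1, d)^(1/(2d))` tends to `1` because the binomial coefficient is
bounded by a polynomial in `d`. None of this uses strong connectivity.

The limit defining `cjsr` exists by Fekete's lemma, since a word of length `s + t` splits into
accepted words of lengths `s` and `t`. It satisfies: if `cjsr T < r`, then the products along
accepted words of length `t` are `O(r ^ t)`, and conversely such a bound gives `cjsr T ≤ r`.

The inequality `cjsr T ≤ lmiValue T` holds because a feasible family `Q` is a family of Euclidean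
norms, one for each node, that grow by a factor of at most `γ` along each edge. For the other inequality
take `γ > cjsr T`. The numbers `sup ‖Π x‖_∞ / γ ^ t`, over the products `Π` along the paths of
length `t` that start at `v`, are norms, one for each `v`, that grow by a factor of at most `γ`
along each edge, and John's theorem replaces each of them by a Euclidean norm at the cost of a factor `√N`. The
version of John's theorem used here, `Matrix.exists_posDef_john`, speaks of the set `U` of
functionals defining the norm instead of the norm. It maximises the determinant over the positive
semidefinite forms dominated by `sup (u ⬝ᵥ x)²`; comparing the maximiser `Q` with the normalised
rank-one perturbations `(1 + μ)⁻¹ (Q + μ u uᵀ)` as `μ → 0` gives `uᵀ Q⁻¹ u ≤ N` for all `u ∈ U`.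

For `lift_cjsr`, the lifted products act on the lifted vectors by `(Π x)^[d]`, of norm `‖Π x‖ ^ d`,
which gives `≥`. Lifted vectors span the whole space, so pointwise bounds on them extend to all
vectors, and the uniform boundedness principle gives `≤`.
-/

open scoped Matrix

/-! ### Fekete's lemma for submultiplicative sequences -/

/-- Fekete's lemma for a nonnegative submultiplicative sequence. The terms may vanish or decay
faster than any exponential, so that their logarithms are not covered by `Subadditive.tendsto_lim`;
the lemma is applied to `max (M n) (δ ^ n)` for `δ > 0`, which is again submultiplicative. -/
theorem exists_tendsto_rpow_one_div_of_submultiplicative {M : ℕ → ℝ} (h0 : ∀ n, 0 ≤ M n)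
    (hM : ∀ m n, M (m + n) ≤ M m * M n) :
    ∃ L, Tendsto (fun n : ℕ => M n ^ (1 / (n : ℝ))) atTop (𝓝 L) := by
  have key : ∀ δ : ℝ, 0 < δ → δ < 1 →
      ∃ L, Tendsto (fun n : ℕ => max (M n ^ (1 / (n : ℝ))) δ) atTop (𝓝 L) := by
    intro δ hδ hδ1
    have hpos : ∀ n, 0 < max (M n) (δ ^ n) := fun n => lt_max_of_lt_right (pow_pos hδ n)
    have hsub : Subadditive fun n => Real.log (max (M n) (δ ^ n)) := by
      intro m n
      rw [← Real.log_mul (hpos m).ne' (hpos n).ne']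
      refine Real.log_le_log (hpos _) (max_le ((hM m n).trans ?_) ?_)
      · exact mul_le_mul (le_max_left _ _) (le_max_left _ _) (h0 n) (hpos m).le
      · rw [pow_add]
        exact mul_le_mul (le_max_right _ _) (le_max_right _ _) (pow_pos hδ n).le (hpos m).le
    have hbdd : BddBelow (Set.range fun n : ℕ => Real.log (max (M n) (δ ^ n)) / n) := by
      refine ⟨Real.log δ, ?_⟩
      rintro _ ⟨n, rfl⟩
      rcases Nat.eq_zero_or_pos n with rfl | hn
      · simpa using Real.log_nonpos hδ.le hδ1.le
      · have hn' : (0 : ℝ) < n := Nat.cast_pos.2 hn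
        rw [le_div_iff₀ hn', mul_comm, ← Real.log_pow]
        exact Real.log_le_log (pow_pos hδ n) (le_max_right _ _)
    have hlim := (Real.continuous_exp.tendsto _).comp (hsub.tendsto_lim hbdd)
    refine ⟨_, hlim.congr' ?_⟩
    filter_upwards [eventually_gt_atTop 0] with n hn
    have hn' : (0 : ℝ) < n := Nat.cast_pos.2 hn
    have h1 : Real.exp (Real.log (max (M n) (δ ^ n)) / n) =
        (max (M n) (δ ^ n)) ^ (1 / (n : ℝ)) := by
      rw [Real.rpow_def_of_pos (hpos n), mul_one_div]
    have h2 : (δ ^ n) ^ (1 / (n : ℝ)) = δ := by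
      rw [one_div, Real.pow_rpow_inv_natCast hδ.le hn.ne']
    have hmono : Monotone fun x : ℝ => max x 0 ^ (1 / (n : ℝ)) := fun x y hxy =>
      Real.rpow_le_rpow (le_max_right _ _) (max_le_max_right _ hxy) (by positivity)
    have h3 := hmono.map_max (a := M n) (b := δ ^ n)
    simp only [max_eq_left (h0 n), max_eq_left (pow_pos hδ n).le, max_eq_left (hpos n).le] at h3
    simp only [Function.comp, h1]
    rw [h3, h2]
  -- Either some truncation level lies below its limit and is eventually irrelevant, or the sequence
  -- is eventually below every positive number.
  by_cases hex : ∃ δ : ℝ, 0 < δ ∧ ∃ L, δ < L ∧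
      Tendsto (fun n : ℕ => max (M n ^ (1 / (n : ℝ))) δ) atTop (𝓝 L)
  · obtain ⟨δ, hδ, L, hL, hT⟩ := hex
    refine ⟨L, hT.congr' ?_⟩
    filter_upwards [hT.eventually (lt_mem_nhds hL)] with n hn
    rcases lt_max_iff.1 hn with h | h
    · exact max_eq_left h.le
    · exact absurd h (lt_irrefl _)
  · refine ⟨0, tendsto_order.2 ⟨fun a ha => Eventually.of_forall fun n =>
      ha.trans_le (Real.rpow_nonneg (h0 n) _), fun a ha => ?_⟩⟩
    have hδ : 0 < min (a / 2) (1 / 2) := by positivity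
    obtain ⟨L, hT⟩ := key _ hδ ((min_le_right _ _).trans_lt (by norm_num))
    have hL : L ≤ min (a / 2) (1 / 2) := not_lt.1 fun h => hex ⟨_, hδ, L, h, hT⟩
    have hLa : L < a := (hL.trans (min_le_left _ _)).trans_lt (by linarith)
    filter_upwards [hT.eventually (gt_mem_nhds hLa)] with n hn
    exact (le_max_left _ _).trans_lt hn

/-! ### John's theorem for positive definite forms -/

namespace Matrix

variable {ι : Type*} [Fintype ι]

theorem dotProduct_vecMulVec_self_mulVec (u x : ι → ℝ) :
    x ⬝ᵥ vecMulVec u u *ᵥ x = (u ⬝ᵥ x) ^ 2 := by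
  rw [Matrix.vecMulVec_mulVec, dotProduct_comm]
  simp [sq]

variable [DecidableEq ι]

theorem PosSemidef.two_mul_abs_apply_le {Q : Matrix ι ι ℝ} (hQ : Q.PosSemidef) (i j : ι) :
    2 * |Q i j| ≤ Q i i + Q j j := by
  have hs : Q j i = Q i j := by simpa using (hQ.isHermitian.apply j i).symm
  have h1 := hQ.dotProduct_mulVec_nonneg (Pi.single i 1 + Pi.single j 1)
  have h2 := hQ.dotProduct_mulVec_nonneg (Pi.single i 1 - Pi.single j 1)
  simp [Matrix.mulVec_add, Matrix.mulVec_sub, add_dotProduct, sub_dotProduct, hs] at h1 h2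
  rcases abs_cases (Q i j) with h | h <;> linarith [h.1]

/-- Bounds on the values at the basis vectors bound the diagonal entries, and thereby all entries,
of a positive semidefinite matrix. The set `P x` consists of upper bounds for the form at `x`. -/
theorem isCompact_posSemidef_dotProduct_mulVec_le {P : (ι → ℝ) → Set ℝ}
    (hP : ∀ x, (P x).Nonempty) :
    IsCompact {Q : Matrix ι ι ℝ | Q.PosSemidef ∧ ∀ x, ∀ B ∈ P x, x ⬝ᵥ Q *ᵥ x ≤ B} := by
  choose R hR using fun i : ι => hP (Pi.single i 1)
  have hbox : IsCompact (Set.pi Set.univ fun i : ι => Set.pi Set.univ fun j : ι =>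
      Set.Icc (-(R i + R j)) (R i + R j)) :=
    isCompact_univ_pi fun i => isCompact_univ_pi fun j => isCompact_Icc
  refine hbox.of_isClosed_subset ?_ ?_
  · have hform : ∀ x : ι → ℝ, Continuous fun Q : Matrix ι ι ℝ => x ⬝ᵥ Q *ᵥ x := fun x => by
      fun_prop
    have heq : {Q : Matrix ι ι ℝ | Q.PosSemidef ∧ ∀ x, ∀ B ∈ P x, x ⬝ᵥ Q *ᵥ x ≤ B} =
        {Q | Qᵀ = Q} ∩ ((⋂ x, {Q | 0 ≤ x ⬝ᵥ Q *ᵥ x}) ∩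
          ⋂ x, ⋂ B ∈ P x, {Q | x ⬝ᵥ Q *ᵥ x ≤ B}) := by
      ext Q
      simp only [Matrix.posSemidef_iff_dotProduct_mulVec, Matrix.IsHermitian,
        Matrix.conjTranspose_eq_transpose_of_trivial, star_trivial, Set.mem_inter_iff,
        Set.mem_iInter, Set.mem_ofPred_eq, and_assoc]
    rw [heq]
    refine (isClosed_eq (by fun_prop) continuous_id).inter ((isClosed_iInter fun x =>
      isClosed_le continuous_const (hform x)).inter (isClosed_iInter fun x =>
        isClosed_biInter fun B _ => isClosed_le (hform x) continuous_const))
  · have hent : ∀ Q : Matrix ι ι ℝ, Q.PosSemidef → (∀ x, ∀ B ∈ P x, x ⬝ᵥ Q *ᵥ x ≤ B) →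
        ∀ i j, |Q i j| ≤ R i + R j := by
      intro Q hQ hle i j
      have hd : ∀ k, Q k k ≤ R k := fun k => by
        have hk := hle _ _ (hR k)
        rwa [Matrix.mulVec_single_one, single_one_dotProduct, Matrix.col_apply] at hk
      linarith [abs_nonneg (Q i j), hd i, hd j, hQ.two_mul_abs_apply_le i j]
    exact fun Q hQ i _ j _ => abs_le.1 (hent Q hQ.1 hQ.2 i j)

/-- Cauchy–Schwarz inequality for the dual forms `Q⁻¹` and `Q`. -/
theorem PosDef.sq_dotProduct_le {Q : Matrix ι ι ℝ} (hQ : Q.PosDef) (u x : ι → ℝ) :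
    (u ⬝ᵥ x) ^ 2 ≤ (u ⬝ᵥ Q⁻¹ *ᵥ u) * (x ⬝ᵥ Q *ᵥ x) := by
  set y := Q⁻¹ *ᵥ u with hy
  have hdet : IsUnit Q.det := (Matrix.isUnit_iff_isUnit_det _).1 hQ.isUnit
  have hu : Q *ᵥ y = u := by
    rw [hy, Matrix.mulVec_mulVec, Matrix.mul_nonsing_inv _ hdet, Matrix.one_mulVec]
  have hsymm : x ⬝ᵥ u = y ⬝ᵥ Q *ᵥ x := by
    have hT : Qᵀ = Q := by simpa [Matrix.IsHermitian] using hQ.isHermitian.eq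
    rw [← hu, Matrix.dotProduct_mulVec, ← Matrix.mulVec_transpose, hT, dotProduct_comm]
  have hnn : ∀ t : ℝ, 0 ≤ (x ⬝ᵥ Q *ᵥ x) * (t * t) + (2 * (u ⬝ᵥ x)) * t + u ⬝ᵥ y := by
    intro t
    have h := hQ.posSemidef.dotProduct_mulVec_nonneg (t • x + y)
    simp only [star_trivial, Matrix.mulVec_add, Matrix.mulVec_smul, add_dotProduct,
      dotProduct_add, smul_dotProduct, dotProduct_smul, hu, smul_eq_mul, ← hsymm] at h
    rw [dotProduct_comm x u, dotProduct_comm y u] at h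
    linarith
  have := discrim_le_zero hnn
  rw [discrim] at this
  nlinarith

/-- Matrix determinant lemma for a symmetric rank-one perturbation. -/
theorem det_add_smul_vecMulVec {Q : Matrix ι ι ℝ} (hQ : IsUnit Q.det) (μ : ℝ) (u : ι → ℝ) :
    (Q + μ • vecMulVec u u).det = Q.det * (1 + μ * (u ⬝ᵥ Q⁻¹ *ᵥ u)) := by
  have h := Matrix.det_add_replicateCol_mul_replicateRow (ι := Unit) hQ (μ • u) u
  have h1 : replicateCol Unit (μ • u) * replicateRow Unit u = μ • vecMulVec u u := by
    ext i j; simp [Matrix.mul_apply, vecMulVec_apply, mul_assoc]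
  rw [h1] at h
  rw [h]
  congr 1
  rw [Matrix.det_unique]
  simp [Matrix.mul_assoc, Matrix.mul_apply, dotProduct, Matrix.mulVec, Finset.mul_sum]

/-- John's theorem for the norm `sup_{u ∈ U} |u ⬝ᵥ x|`: some Euclidean norm lies below it and, after
multiplication by `√(card ι)`, above it. The supremum is expressed through the upper bounds `B` of
`{(u ⬝ᵥ x) ^ 2 | u ∈ U}`. -/
theorem exists_posDef_john [Nonempty ι] {U : Set (ι → ℝ)} (hbasis : ∀ i, Pi.single i 1 ∈ U)
    (hbdd : ∀ x, ∃ B, ∀ u ∈ U, (u ⬝ᵥ x) ^ 2 ≤ B) :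
    ∃ Q : Matrix ι ι ℝ, Q.PosDef ∧
      (∀ x B, (∀ u ∈ U, (u ⬝ᵥ x) ^ 2 ≤ B) → x ⬝ᵥ Q *ᵥ x ≤ B) ∧
      ∀ u ∈ U, ∀ x, (u ⬝ᵥ x) ^ 2 ≤ Fintype.card ι * (x ⬝ᵥ Q *ᵥ x) := by
  let K : Set (Matrix ι ι ℝ) := {Q | Q.PosSemidef ∧
    ∀ x B, (∀ u ∈ U, (u ⬝ᵥ x) ^ 2 ≤ B) → x ⬝ᵥ Q *ᵥ x ≤ B}
  have hK : IsCompact K := 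
    isCompact_posSemidef_dotProduct_mulVec_le (P := fun x => {B | ∀ u ∈ U, (u ⬝ᵥ x) ^ 2 ≤ B}) hbdd
  let N : ℝ := Fintype.card ι
  have hN : 0 < N := Nat.cast_pos.2 Fintype.card_pos
  have h1K : N⁻¹ • (1 : Matrix ι ι ℝ) ∈ K := by
    refine ⟨Matrix.PosSemidef.one.smul (inv_nonneg.2 hN.le), fun x B hB => ?_⟩
    have h : ∑ i, x i * x i ≤ ∑ _i : ι, B := Finset.sum_le_sum fun i _ => by
      simpa [sq] using hB _ (hbasis i)
    simp only [Finset.sum_const, Finset.card_univ, nsmul_eq_mul] at h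
    rw [Matrix.smul_mulVec, Matrix.one_mulVec, dotProduct_smul, smul_eq_mul,
      inv_mul_le_iff₀ hN]
    exact h
  obtain ⟨Q, hQK, hmax⟩ := hK.exists_isMaxOn ⟨_, h1K⟩
    (Continuous.matrix_det continuous_id).continuousOn
  have hdet : 0 < Q.det := by
    refine lt_of_lt_of_le ?_ (hmax h1K)
    simp only [id, Matrix.det_smul, Matrix.det_one]
    positivity
  have hQ : Q.PosDef := hQK.1.posDef_iff_det_ne_zero.2 hdet.ne'
  refine ⟨Q, hQ, hQK.2, fun u hu x => ?_⟩
  set s := u ⬝ᵥ Q⁻¹ *ᵥ u with hs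
  -- The perturbation `(1 + μ)⁻¹ (Q + μ u uᵀ)` is a convex combination of `Q` and `u uᵀ`, so it
  -- stays in `K`, and its determinant does not exceed that of `Q`.
  have hμ : ∀ μ : ℝ, 0 < μ → 1 + μ * s ≤ (1 + μ) ^ Fintype.card ι := by
    intro μ hμ
    have hmem : (1 + μ)⁻¹ • (Q + μ • vecMulVec u u) ∈ K := by
      refine ⟨(hQK.1.add ?_).smul (by positivity), fun y B hB => ?_⟩
      · exact (by simpa using Matrix.posSemidef_vecMulVec_self_star u :
          (vecMulVec u u).PosSemidef).smul hμ.le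
      · rw [Matrix.smul_mulVec, Matrix.add_mulVec, Matrix.smul_mulVec, dotProduct_smul,
          dotProduct_add, dotProduct_smul, dotProduct_vecMulVec_self_mulVec, smul_eq_mul,
          smul_eq_mul, inv_mul_le_iff₀ (by positivity)]
        nlinarith [hQK.2 y B hB, hB u hu]
    have h := hmax hmem
    simp only [id, Set.mem_ofPred_eq, Matrix.det_smul,
      det_add_smul_vecMulVec hdet.ne'.isUnit, inv_pow] at h
    rw [inv_mul_le_iff₀ (by positivity), mul_comm (_ ^ _)] at h
    exact le_of_mul_le_mul_left h hdet
  -- Divide by `μ` and let `μ → 0`.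
  have hsN : s ≤ N := by
    have hd : HasDerivAt (fun μ : ℝ => (1 + μ) ^ Fintype.card ι) N 0 := by
      simpa [N] using ((hasDerivAt_id' (0 : ℝ)).const_add 1).fun_pow (Fintype.card ι)
    have hl := (hasDerivAt_iff_tendsto_slope_zero.1 hd).mono_left
      (nhdsWithin_mono 0 (fun x (hx : 0 < x) => hx.ne') : 𝓝[>] (0 : ℝ) ≤ 𝓝[≠] 0)
    refine ge_of_tendsto hl ?_
    filter_upwards [self_mem_nhdsWithin] with μ (hpos : 0 < μ)
    have := hμ μ hpos
    simp only [zero_add, add_zero, one_pow, smul_eq_mul]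
    rw [le_inv_mul_iff₀ hpos]
    linarith
  refine (hQ.sq_dotProduct_le u x).trans (mul_le_mul_of_nonneg_right hsN ?_)
  simpa using hQ.posSemidef.dotProduct_mulVec_nonneg x

end Matrix

/-! ### Products along accepted words and the growth rate -/

namespace SwitchingSystem

section Words

variable {ι : Type*} {V : Type u} {Λ : Type v} {S : SwitchingSystem ι V Λ}

theorem IsPath.of_append {l₁ l₂ : List Λ} {v w : V} (h : S.IsPath v (l₁ ++ l₂) w) :
    ∃ z, S.IsPath v l₁ z ∧ S.IsPath z l₂ w := by
  induction l₁ generalizing v with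
  | nil => exact ⟨v, .nil v, h⟩
  | cons σ l ih =>
    cases h with
    | cons he hp =>
      obtain ⟨z, h₁, h₂⟩ := ih hp
      exact ⟨z, .cons he h₁, h₂⟩

theorem Accepts.of_append {l₁ l₂ : List Λ} (h : S.Accepts (l₁ ++ l₂)) :
    S.Accepts l₁ ∧ S.Accepts l₂ := by
  obtain ⟨v, w, h⟩ := h
  obtain ⟨z, h₁, h₂⟩ := h.of_append
  exact ⟨⟨v, z, h₁⟩, ⟨z, w, h₂⟩⟩

theorem finite_image_words [Finite Λ] {α : Type*} (S : SwitchingSystem ι V Λ) (f : List Λ → α)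
    (t : ℕ) :
    (f '' {l | l.length = t ∧ S.Accepts l}).Finite :=
  ((List.finite_length_eq Λ t).subset fun _ hl => hl.1).image _

variable [Fintype ι] [DecidableEq ι]

theorem wordProd_append (S : SwitchingSystem ι V Λ) (l₁ l₂ : List Λ) :
    S.wordProd (l₁ ++ l₂) = S.wordProd l₂ * S.wordProd l₁ := by
  induction l₁ with
  | nil => simp [wordProd]
  | cons σ l ih => simp [wordProd, ih, Matrix.mul_assoc]

/-- The Euclidean operator norm of the product along a word. -/
noncomputable def wordNorm (S : SwitchingSystem ι V Λ) (l : List Λ) : ℝ :=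
  ‖Matrix.toEuclideanCLM (𝕜 := ℝ) (S.wordProd l)‖

theorem wordNorm_nonneg (S : SwitchingSystem ι V Λ) (l : List Λ) : 0 ≤ S.wordNorm l :=
  norm_nonneg _

theorem wordNorm_append_le (S : SwitchingSystem ι V Λ) (l₁ l₂ : List Λ) :
    S.wordNorm (l₁ ++ l₂) ≤ S.wordNorm l₁ * S.wordNorm l₂ := by
  rw [wordNorm, wordProd_append, map_mul, mul_comm]
  exact norm_mul_le _ _

theorem norm_wordProd_mulVec_le (S : SwitchingSystem ι V Λ) (l : List Λ) (x : ι → ℝ) :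
    ‖WithLp.toLp 2 (S.wordProd l *ᵥ x)‖ ≤ S.wordNorm l * ‖WithLp.toLp 2 x‖ :=
  (Matrix.toEuclideanCLM (𝕜 := ℝ) (S.wordProd l)).le_opNorm (WithLp.toLp 2 x)

theorem wordNorm_le (S : SwitchingSystem ι V Λ) (l : List Λ) {C : ℝ} (hC : 0 ≤ C)
    (h : ∀ x : ι → ℝ, ‖WithLp.toLp 2 (S.wordProd l *ᵥ x)‖ ≤ C * ‖WithLp.toLp 2 x‖) :
    S.wordNorm l ≤ C :=
  ContinuousLinearMap.opNorm_le_bound _ hC fun x => h x.ofLp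

/-- The maximal norm of a product along an accepted word of length `t`, or `0` if there is no such
word. -/
noncomputable def maxNorm (S : SwitchingSystem ι V Λ) (t : ℕ) : ℝ :=
  sSup (S.wordNorm '' {l | l.length = t ∧ S.Accepts l})

theorem maxNorm_nonneg (S : SwitchingSystem ι V Λ) (t : ℕ) : 0 ≤ S.maxNorm t :=
  Real.sSup_nonneg (by rintro _ ⟨l, -, rfl⟩; exact S.wordNorm_nonneg l)

section Finite

variable [Finite Λ]

theorem wordNorm_le_maxNorm {l : List Λ} (hl : S.Accepts l) :
    S.wordNorm l ≤ S.maxNorm l.length :=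
  le_csSup (S.finite_image_words _ _).bddAbove ⟨l, ⟨rfl, hl⟩, rfl⟩

theorem maxNorm_add_le (S : SwitchingSystem ι V Λ) (s t : ℕ) :
    S.maxNorm (s + t) ≤ S.maxNorm s * S.maxNorm t := by
  refine Real.sSup_le ?_ (mul_nonneg (S.maxNorm_nonneg s) (S.maxNorm_nonneg t))
  rintro _ ⟨l, ⟨hlen, hacc⟩, rfl⟩
  rw [← List.take_append_drop s l] at hacc ⊢
  obtain ⟨h₁, h₂⟩ := hacc.of_append
  have e₁ := wordNorm_le_maxNorm h₁
  have e₂ := wordNorm_le_maxNorm h₂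
  rw [List.length_take, hlen, min_eq_left (Nat.le_add_right s t)] at e₁
  rw [List.length_drop, hlen, Nat.add_sub_cancel_left] at e₂
  exact (S.wordNorm_append_le _ _).trans
    (mul_le_mul e₁ e₂ (S.wordNorm_nonneg _) (S.maxNorm_nonneg _))

theorem growth_eq (S : SwitchingSystem ι V Λ) {t : ℕ} (ht : t ≠ 0) :
    S.growth t = S.maxNorm t ^ (1 / (t : ℝ)) := by
  have hset : {a : ℝ | ∃ l : List Λ, l.length = t ∧ S.Accepts l ∧
      a = ‖Matrix.toEuclideanCLM (𝕜 := ℝ) (S.wordProd l)‖ ^ (1 / (t : ℝ))} =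
      (fun l => S.wordNorm l ^ (1 / (t : ℝ))) '' {l | l.length = t ∧ S.Accepts l} := by
    ext a
    constructor
    · rintro ⟨l, h₁, h₂, rfl⟩
      exact ⟨l, ⟨h₁, h₂⟩, rfl⟩
    · rintro ⟨l, ⟨h₁, h₂⟩, rfl⟩
      exact ⟨l, h₁, h₂, rfl⟩
  rw [growth, hset]
  refine le_antisymm (Real.sSup_le ?_ (Real.rpow_nonneg (S.maxNorm_nonneg t) _)) ?_
  · rintro _ ⟨l, ⟨rfl, hl⟩, rfl⟩
    exact Real.rpow_le_rpow (S.wordNorm_nonneg l) (wordNorm_le_maxNorm hl) (by positivity)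
  · rcases ({l | l.length = t ∧ S.Accepts l}).eq_empty_or_nonempty with he | hne
    · rw [maxNorm, he]
      simp [ht]
    · obtain ⟨l, hl, hlt⟩ := (hne.image S.wordNorm).csSup_mem (S.finite_image_words _ t)
      rw [maxNorm, ← hlt]
      exact le_csSup (S.finite_image_words _ t).bddAbove ⟨l, hl, rfl⟩

theorem tendsto_growth (S : SwitchingSystem ι V Λ) : Tendsto S.growth atTop (𝓝 S.cjsr) := by
  obtain ⟨L, hL⟩ := exists_tendsto_rpow_one_div_of_submultiplicative S.maxNorm_nonneg
    S.maxNorm_add_le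
  refine tendsto_nhds_limUnder ⟨L, hL.congr' ?_⟩
  filter_upwards [eventually_ne_atTop 0] with t ht
  exact (S.growth_eq ht).symm

theorem cjsr_nonneg (S : SwitchingSystem ι V Λ) : 0 ≤ S.cjsr := by
  refine ge_of_tendsto S.tendsto_growth ?_
  filter_upwards [eventually_ne_atTop 0] with t ht
  rw [S.growth_eq ht]
  exact Real.rpow_nonneg (S.maxNorm_nonneg t) _

theorem cjsr_le_of_wordNorm_le {C r : ℝ} (hC : 0 < C) (hr : 0 ≤ r)
    (h : ∀ l, S.Accepts l → S.wordNorm l ≤ C * r ^ l.length) : S.cjsr ≤ r := by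
  have hlim : Tendsto (fun t : ℕ => C ^ (1 / (t : ℝ)) * r) atTop (𝓝 r) := by
    have h1 := (Real.continuousAt_const_rpow (b := 0) hC.ne').tendsto.comp
      (tendsto_one_div_atTop_nhds_zero_nat (𝕜 := ℝ))
    simpa using h1.mul_const r
  refine le_of_tendsto_of_tendsto S.tendsto_growth hlim ?_
  filter_upwards [eventually_ne_atTop 0] with t ht
  have hM : S.maxNorm t ≤ C * r ^ t := by
    refine Real.sSup_le ?_ (by positivity)
    rintro _ ⟨l, ⟨rfl, hl⟩, rfl⟩
    exact h l hl
  rw [S.growth_eq ht]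
  refine (Real.rpow_le_rpow (S.maxNorm_nonneg t) hM (by positivity)).trans_eq ?_
  rw [Real.mul_rpow hC.le (by positivity), one_div, Real.pow_rpow_inv_natCast hr ht]

/-- Beyond some length the bound holds with constant `1`; the finitely many shorter words are
absorbed into the constant. -/
theorem exists_wordNorm_le_of_cjsr_lt {r : ℝ} (hr : S.cjsr < r) :
    ∃ C, 0 ≤ C ∧ ∀ l, S.Accepts l → S.wordNorm l ≤ C * r ^ l.length := by
  have hr0 : 0 < r := S.cjsr_nonneg.trans_lt hr
  obtain ⟨T, hT⟩ := eventually_atTop.1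
    ((S.tendsto_growth.eventually (gt_mem_nhds hr)).and (eventually_ne_atTop 0))
  obtain ⟨B, hB⟩ := ((List.finite_length_lt Λ T).image
    fun l => S.wordNorm l / r ^ l.length).bddAbove
  refine ⟨max 1 B, by positivity, fun l hl => ?_⟩
  rcases lt_or_ge l.length T with h | h
  · have := hB ⟨l, h, rfl⟩
    rw [← div_le_iff₀ (by positivity)]
    exact this.trans (le_max_right _ _)
  · obtain ⟨hg, h0⟩ := hT _ h
    rw [S.growth_eq h0, one_div,
      Real.rpow_inv_lt_iff_of_pos (S.maxNorm_nonneg _) hr0.le (by positivity),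
      Real.rpow_natCast] at hg
    calc S.wordNorm l ≤ r ^ l.length := (wordNorm_le_maxNorm hl).trans hg.le
      _ ≤ max 1 B * r ^ l.length := le_mul_of_one_le_left (by positivity) (le_max_left _ _)

end Finite

end Words

end SwitchingSystem

/-! ### The LMI value compared with the constrained joint spectral radius -/

namespace Matrix

variable {ι : Type*} [Fintype ι]

theorem norm_toLp_sq (x : ι → ℝ) : ‖WithLp.toLp 2 x‖ ^ 2 = x ⬝ᵥ x := by
  rw [EuclideanSpace.norm_sq_eq]
  simp [dotProduct, sq]

theorem dotProduct_mulVec_le_sum_abs (Q : Matrix ι ι ℝ) (x : ι → ℝ) :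
    x ⬝ᵥ Q *ᵥ x ≤ (∑ i, ∑ j, |Q i j|) * ‖WithLp.toLp 2 x‖ ^ 2 := by
  have hx : ∀ i, |x i| ≤ ‖WithLp.toLp 2 x‖ := fun i => PiLp.norm_apply_le (WithLp.toLp 2 x) i
  simp only [dotProduct, Matrix.mulVec, Finset.mul_sum, Finset.sum_mul]
  refine Finset.sum_le_sum fun i _ => Finset.sum_le_sum fun j _ => ?_
  calc x i * (Q i j * x j) ≤ |x i * (Q i j * x j)| := le_abs_self _
    _ = |Q i j| * (|x i| * |x j|) := by rw [abs_mul, abs_mul]; ring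
    _ ≤ |Q i j| * ‖WithLp.toLp 2 x‖ ^ 2 := by
      rw [sq]
      gcongr
      exacts [hx i, hx j]

variable [DecidableEq ι]

theorem PosDef.norm_sq_le {Q : Matrix ι ι ℝ} (hQ : Q.PosDef) (x : ι → ℝ) :
    ‖WithLp.toLp 2 x‖ ^ 2 ≤ Q⁻¹.trace * (x ⬝ᵥ Q *ᵥ x) := by
  rw [norm_toLp_sq, dotProduct, Matrix.trace, Finset.sum_mul]
  refine Finset.sum_le_sum fun i _ => ?_
  have h := hQ.sq_dotProduct_le (Pi.single i 1) x
  rw [Matrix.mulVec_single_one, single_one_dotProduct, single_one_dotProduct,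
    Matrix.col_apply] at h
  rwa [← sq]

end Matrix

namespace SwitchingSystem

variable {ι : Type*} {V : Type u} {Λ : Type v} {S : SwitchingSystem ι V Λ}
  [Fintype ι] [DecidableEq ι]

/-- Along a path of length `t`, the quadratic forms of a feasible family grow at most by the
factor `γ ^ (2t)`. -/
theorem dotProduct_mulVec_le_of_isPath {γ : ℝ} {Q : V → Matrix ι ι ℝ}
    (hQ : ∀ v w σ, (v, w, σ) ∈ S.edges →
      (-((S.A σ).transpose * Q w * S.A σ) + γ ^ 2 • Q v).PosSemidef)
    {v w : V} {l : List Λ} (h : S.IsPath v l w) (x : ι → ℝ) :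
    (S.wordProd l *ᵥ x) ⬝ᵥ Q w *ᵥ (S.wordProd l *ᵥ x) ≤
      (γ ^ l.length) ^ 2 * (x ⬝ᵥ Q v *ᵥ x) := by
  induction h generalizing x with
  | nil v => simp [wordProd]
  | @cons v w z σ l he hp ih =>
    have h1 := (hQ v w σ he).dotProduct_mulVec_nonneg x
    simp only [star_trivial, Matrix.add_mulVec, Matrix.neg_mulVec, Matrix.smul_mulVec,
      dotProduct_add, dotProduct_neg, dotProduct_smul, smul_eq_mul, ← Matrix.mulVec_mulVec] at h1
    rw [Matrix.dotProduct_mulVec x, Matrix.vecMul_transpose] at h1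
    have h2 := ih (S.A σ *ᵥ x)
    rw [wordProd, ← Matrix.mulVec_mulVec, List.length_cons]
    refine h2.trans ?_
    rw [pow_succ γ, mul_pow, mul_assoc]
    exact mul_le_mul_of_nonneg_left (by linarith) (by positivity)

theorem LMIFeasible.exists_wordNorm_le [Finite V] {γ : ℝ} (h : S.LMIFeasible γ) :
    ∃ C, 0 < C ∧ ∀ l, S.Accepts l → S.wordNorm l ≤ C * γ ^ l.length := by
  cases nonempty_fintype V
  obtain ⟨hγ, Q, hpos, hQ⟩ := h
  set a := ∑ v, (Q v)⁻¹.trace with ha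
  set b := ∑ v, ∑ i, ∑ j, |Q v i j| with hb
  have htr : ∀ v, 0 ≤ (Q v)⁻¹.trace := fun v => (hpos v).inv.posSemidef.trace_nonneg
  have ha0 : 0 ≤ a := Finset.sum_nonneg fun v _ => htr v
  have hb0 : 0 ≤ b := by positivity
  -- The summand `1` only makes the constant positive.
  refine ⟨√(a * b) + 1, by positivity, ?_⟩
  rintro l ⟨v, w, hp⟩
  refine S.wordNorm_le l (by positivity) fun x => ?_
  refine (pow_le_pow_iff_left₀ (norm_nonneg _) (by positivity) two_ne_zero).1 ?_
  have hxx : 0 ≤ x ⬝ᵥ Q v *ᵥ x := by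
    simpa using (hpos v).posSemidef.dotProduct_mulVec_nonneg x
  have hyy : 0 ≤ (S.wordProd l *ᵥ x) ⬝ᵥ Q w *ᵥ (S.wordProd l *ᵥ x) := by
    simpa using (hpos w).posSemidef.dotProduct_mulVec_nonneg (S.wordProd l *ᵥ x)
  calc ‖WithLp.toLp 2 (S.wordProd l *ᵥ x)‖ ^ 2
      ≤ (Q w)⁻¹.trace * ((S.wordProd l *ᵥ x) ⬝ᵥ Q w *ᵥ (S.wordProd l *ᵥ x)) :=
        (hpos w).norm_sq_le _
    _ ≤ a * ((S.wordProd l *ᵥ x) ⬝ᵥ Q w *ᵥ (S.wordProd l *ᵥ x)) := by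
        gcongr
        exact Finset.single_le_sum (f := fun v => (Q v)⁻¹.trace) (fun v _ => htr v)
          (Finset.mem_univ w)
    _ ≤ a * ((γ ^ l.length) ^ 2 * (x ⬝ᵥ Q v *ᵥ x)) := by
        gcongr
        exact dotProduct_mulVec_le_of_isPath hQ hp x
    _ ≤ a * ((γ ^ l.length) ^ 2 * (b * ‖WithLp.toLp 2 x‖ ^ 2)) := by
        gcongr
        refine (Matrix.dotProduct_mulVec_le_sum_abs (Q v) x).trans ?_
        gcongr
        exact Finset.single_le_sum (f := fun v => ∑ i, ∑ j, |Q v i j|)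
          (fun v _ => by positivity) (Finset.mem_univ v)
    _ = (√(a * b) * γ ^ l.length * ‖WithLp.toLp 2 x‖) ^ 2 := by
        rw [mul_pow, mul_pow, Real.sq_sqrt (mul_nonneg ha0 hb0)]
        ring
    _ ≤ ((√(a * b) + 1) * γ ^ l.length * ‖WithLp.toLp 2 x‖) ^ 2 := by
        gcongr
        linarith

theorem cjsr_le_lmiValue [Finite V] [Finite Λ] (S : SwitchingSystem ι V Λ) :
    S.cjsr ≤ S.lmiValue :=
  le_csInf S.exists_lmiFeasible fun γ hγ => by
    obtain ⟨C, hC, h⟩ := LMIFeasible.exists_wordNorm_le hγ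
    exact cjsr_le_of_wordNorm_le hC hγ.1 h

/-- The form at the node `v` comes from John's theorem for the set of all rows of `γ ^ (-t) Π`,
where `Π` is the product along a path of length `t` starting at `v`. Prefixing an edge `(v, w, σ)`
to a path from `w` turns such functionals at `w`, composed with `A σ`, into `γ` times functionals at
`v`. -/
theorem lmiFeasible_of_wordNorm_le {γ C : ℝ} (hγ : 0 < γ) (hC : 0 ≤ C)
    (h : ∀ l, S.Accepts l → S.wordNorm l ≤ C * γ ^ l.length) :
    S.LMIFeasible (√(Fintype.card ι) * γ) := by
  refine ⟨by positivity, ?_⟩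
  rcases isEmpty_or_nonempty ι with hι | hι
  · refine ⟨fun _ => 1, fun _ => Matrix.PosDef.one, fun v w σ _ => ?_⟩
    rw [Subsingleton.elim (_ + _) (1 : Matrix ι ι ℝ)]
    exact Matrix.PosSemidef.one
  let U : V → Set (ι → ℝ) := fun v =>
    {u | ∃ l w i, S.IsPath v l w ∧ u = (γ ^ l.length)⁻¹ • S.wordProd l i}
  have hdot : ∀ (l : List Λ) (i : ι) (x : ι → ℝ), ((γ ^ l.length)⁻¹ • S.wordProd l i) ⬝ᵥ x =
      (γ ^ l.length)⁻¹ * (S.wordProd l *ᵥ x) i := fun l i x => by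
    rw [smul_dotProduct, smul_eq_mul]; rfl
  have hJ : ∀ v, ∃ Q : Matrix ι ι ℝ, Q.PosDef ∧
      (∀ x B, (∀ u ∈ U v, (u ⬝ᵥ x) ^ 2 ≤ B) → x ⬝ᵥ Q *ᵥ x ≤ B) ∧
      ∀ u ∈ U v, ∀ x, (u ⬝ᵥ x) ^ 2 ≤ Fintype.card ι * (x ⬝ᵥ Q *ᵥ x) := by
    refine fun v => Matrix.exists_posDef_john (fun i => ?_) fun x => ?_
    -- The empty path contributes the standard basis.
    · refine ⟨[], v, i, .nil v, ?_⟩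
      ext j
      simp [wordProd, Matrix.one_apply, Pi.single_apply, eq_comm]
    · refine ⟨(C * ‖WithLp.toLp 2 x‖) ^ 2, ?_⟩
      rintro _ ⟨l, w, i, hp, rfl⟩
      rw [hdot]
      have hi : |(S.wordProd l *ᵥ x) i| ≤ C * γ ^ l.length * ‖WithLp.toLp 2 x‖ :=
        calc |(S.wordProd l *ᵥ x) i| ≤ ‖WithLp.toLp 2 (S.wordProd l *ᵥ x)‖ :=
              PiLp.norm_apply_le (WithLp.toLp 2 (S.wordProd l *ᵥ x)) i
          _ ≤ S.wordNorm l * ‖WithLp.toLp 2 x‖ := S.norm_wordProd_mulVec_le l x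
          _ ≤ C * γ ^ l.length * ‖WithLp.toLp 2 x‖ := by
              gcongr
              exact h l ⟨v, w, hp⟩
      refine sq_le_sq.2 ?_
      rw [abs_mul, abs_of_pos (by positivity : 0 < (γ ^ l.length)⁻¹),
        abs_of_nonneg (by positivity : 0 ≤ C * ‖WithLp.toLp 2 x‖),
        inv_mul_le_iff₀ (by positivity)]
      linarith
  choose Q hpos hle hge using hJ
  refine ⟨Q, hpos, fun v w σ he => ?_⟩
  refine Matrix.PosSemidef.of_dotProduct_mulVec_nonneg ?_ fun x => ?_
  · have hT : ∀ v, (Q v)ᵀ = Q v := fun v => by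
      simpa [Matrix.IsHermitian] using (hpos v).isHermitian.eq
    simp [Matrix.IsHermitian, Matrix.conjTranspose_eq_transpose_of_trivial, hT, Matrix.mul_assoc]
  · simp only [star_trivial, Matrix.add_mulVec, Matrix.neg_mulVec, Matrix.smul_mulVec,
      dotProduct_add, dotProduct_neg, dotProduct_smul, smul_eq_mul, ← Matrix.mulVec_mulVec]
    rw [Matrix.dotProduct_mulVec x, Matrix.vecMul_transpose, mul_pow,
      Real.sq_sqrt (Nat.cast_nonneg _)]
    -- The domination property at `w` reduces the claim to single functionals of the set at `w`.
    have key := hle w (S.A σ *ᵥ x) (Fintype.card ι * γ ^ 2 * (x ⬝ᵥ Q v *ᵥ x)) ?_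
    · linarith
    rintro _ ⟨l, z, i, hp, rfl⟩
    have h1 := hge v _ ⟨σ :: l, z, i, .cons he hp, rfl⟩ x
    rw [hdot, wordProd, ← Matrix.mulVec_mulVec, List.length_cons] at h1
    rw [hdot]
    calc ((γ ^ l.length)⁻¹ * (S.wordProd l *ᵥ S.A σ *ᵥ x) i) ^ 2
        = γ ^ 2 * ((γ ^ (l.length + 1))⁻¹ * (S.wordProd l *ᵥ S.A σ *ᵥ x) i) ^ 2 := by
          field_simp
          ring
      _ ≤ γ ^ 2 * (Fintype.card ι * (x ⬝ᵥ Q v *ᵥ x)) := by gcongr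
      _ = _ := by ring

theorem lmiValue_le_sqrt_card_mul_cjsr [Finite Λ] (S : SwitchingSystem ι V Λ) :
    S.lmiValue ≤ √(Fintype.card ι) * S.cjsr := by
  have hlim : Tendsto (fun γ => √(Fintype.card ι) * γ) (𝓝[>] S.cjsr)
      (𝓝 (√(Fintype.card ι) * S.cjsr)) :=
    ((continuous_const.mul continuous_id).tendsto _).mono_left nhdsWithin_le_nhds
  refine ge_of_tendsto hlim ?_
  filter_upwards [self_mem_nhdsWithin] with γ (hγ : S.cjsr < γ)
  obtain ⟨C, hC, h⟩ := exists_wordNorm_le_of_cjsr_lt hγ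
  exact csInf_le ⟨0, fun _ h => h.1⟩
    (lmiFeasible_of_wordNorm_le (S.cjsr_nonneg.trans_lt hγ) hC h)

end SwitchingSystem

/-! ### Lifted vectors -/

section Veronese

variable {n : ℕ}

theorem norm_toLp_veroneseVec (d : ℕ) (x : Fin n → ℝ) :
    ‖WithLp.toLp 2 (veroneseVec d x)‖ = ‖WithLp.toLp 2 x‖ ^ d := by
  rw [← pow_left_inj₀ (norm_nonneg _) (by positivity) two_ne_zero, ← pow_mul, mul_comm, pow_mul,
    EuclideanSpace.norm_sq_eq, EuclideanSpace.norm_sq_eq]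
  simpa using sum_sq_veroneseVec d x

/-- A functional vanishing on all lifted vectors is a homogeneous polynomial vanishing on `ℝⁿ`, and
its coefficients are those of the functional up to nonzero factors. -/
theorem span_range_veroneseVec (n d : ℕ) :
    Submodule.span ℝ (Set.range fun x : Fin n → ℝ => veroneseVec d x) = ⊤ := by
  by_contra hne
  obtain ⟨f, hf, hle⟩ := Submodule.exists_le_ker_of_lt_top _ (lt_top_iff_ne_top.2 hne)
  refine hf (LinearMap.pi_ext' fun s => LinearMap.ext_ring ?_)
  set c : Sym (Fin n) d → ℝ := fun s => f (Pi.single s 1) with hc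
  let P : MvPolynomial (Fin n) ℝ := ∑ s : Sym (Fin n) d,
    MvPolynomial.monomial (Multiset.toFinsupp (s : Multiset (Fin n)))
      (c s * √((s : Multiset (Fin n)).countPerms : ℝ))
  have hmon : ∀ (s : Sym (Fin n) d) (x : Fin n → ℝ) (a : ℝ), MvPolynomial.eval x
      (MvPolynomial.monomial (Multiset.toFinsupp (s : Multiset (Fin n))) a) =
      a * ((s : Multiset (Fin n)).map x).prod := by
    intro s x a
    rw [MvPolynomial.eval_monomial, Finset.prod_multiset_map_count]
    rfl
  have hP : P = 0 := by
    refine MvPolynomial.funext fun x => ?_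
    have hx : f (veroneseVec d x) = 0 := hle (Submodule.subset_span ⟨x, rfl⟩)
    rw [map_zero, ← hx, LinearMap.pi_apply_eq_sum_univ f (veroneseVec d x)]
    simp only [P, map_sum, hmon]
    refine Finset.sum_congr rfl fun s _ => ?_
    have : (fun j => if s = j then (1 : ℝ) else 0) = Pi.single s 1 := by
      ext j; simp [Pi.single_apply, eq_comm]
    rw [this, smul_eq_mul, veroneseVec]
    ring
  have hcoeff : MvPolynomial.coeff (Multiset.toFinsupp (s : Multiset (Fin n))) P =
      c s * √((s : Multiset (Fin n)).countPerms : ℝ) := by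
    simp only [P, MvPolynomial.coeff_sum, MvPolynomial.coeff_monomial]
    rw [Finset.sum_eq_single s]
    · simp
    · intro t _ hts
      exact if_neg fun h => hts (Subtype.ext (Multiset.toFinsupp.injective h))
    · simp
  rw [hP, MvPolynomial.coeff_zero, eq_comm, mul_eq_zero] at hcoeff
  have hpos : 0 < √((s : Multiset (Fin n)).countPerms : ℝ) :=
    Real.sqrt_pos.2 (Nat.cast_pos.2 (Nat.multinomial_pos _ _))
  simpa [hc] using hcoeff.resolve_right hpos.ne'

end Veronese

/-! ### The lifted system -/

namespace SwitchingSystem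

variable {n : ℕ} {V : Type u} {Λ : Type v}

theorem lift_accepts {S : SwitchingSystem (Fin n) V Λ} {d : ℕ} {l : List Λ} :
    (S.lift d).Accepts l ↔ S.Accepts l := by
  constructor
  · rintro ⟨v, w, h⟩
    refine ⟨v, w, ?_⟩
    induction h with
    | nil v => exact .nil v
    | cons he _ ih => exact .cons he ih
  · rintro ⟨v, w, h⟩
    refine ⟨v, w, ?_⟩
    induction h with
    | nil v => exact .nil v
    | cons he _ ih => exact .cons he ih

theorem lift_wordProd_mulVec (S : SwitchingSystem (Fin n) V Λ) (d : ℕ) (l : List Λ)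
    (x : Fin n → ℝ) :
    (S.lift d).wordProd l *ᵥ veroneseVec d x = veroneseVec d (S.wordProd l *ᵥ x) := by
  induction l generalizing x with
  | nil => simp [wordProd]
  | cons σ l ih =>
    rw [wordProd, wordProd, ← Matrix.mulVec_mulVec, ← Matrix.mulVec_mulVec, ← ih]
    congr 1
    exact veroneseMatrix_mulVec d (S.A σ) x

theorem wordNorm_pow_le_lift (S : SwitchingSystem (Fin n) V Λ) {d : ℕ} (hd : d ≠ 0)
    (l : List Λ) : S.wordNorm l ^ d ≤ (S.lift d).wordNorm l := by
  have h0 := (S.lift d).wordNorm_nonneg l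
  have h : S.wordNorm l ≤ (S.lift d).wordNorm l ^ ((d : ℝ)⁻¹) := by
    refine S.wordNorm_le l (by positivity) fun x => ?_
    rw [← pow_le_pow_iff_left₀ (norm_nonneg _) (by positivity) hd, mul_pow,
      Real.rpow_inv_natCast_pow h0 hd, ← norm_toLp_veroneseVec, ← norm_toLp_veroneseVec,
      ← lift_wordProd_mulVec]
    exact norm_wordProd_mulVec_le _ l _
  calc S.wordNorm l ^ d ≤ ((S.lift d).wordNorm l ^ ((d : ℝ)⁻¹)) ^ d :=
        pow_le_pow_left₀ (S.wordNorm_nonneg l) h d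
    _ = _ := Real.rpow_inv_natCast_pow h0 hd

/-- The vectors at which the rescaled lifted products are bounded form a subspace containing all
lifted vectors, hence everything; the uniform boundedness principle then bounds the operator
norms. -/
theorem exists_lift_wordNorm_le {S : SwitchingSystem (Fin n) V Λ} {C r : ℝ} (hr : 0 < r)
    (h : ∀ l, S.Accepts l → S.wordNorm l ≤ C * r ^ l.length) (d : ℕ) :
    ∃ C', 0 < C' ∧ ∀ l, (S.lift d).Accepts l →
      (S.lift d).wordNorm l ≤ C' * (r ^ d) ^ l.length := by
  let g : {l // S.Accepts l} →
      (EuclideanSpace ℝ (Sym (Fin n) d) →L[ℝ] EuclideanSpace ℝ (Sym (Fin n) d)) :=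
    fun l => ((r ^ d) ^ l.1.length)⁻¹ • Matrix.toEuclideanCLM (𝕜 := ℝ) ((S.lift d).wordProd l.1)
  let W : Submodule ℝ (Sym (Fin n) d → ℝ) :=
    { carrier := {y | ∃ B, ∀ l, ‖g l (WithLp.toLp 2 y)‖ ≤ B}
      zero_mem' := ⟨0, fun l => by simp⟩
      add_mem' := by
        rintro y z ⟨B, hB⟩ ⟨B', hB'⟩
        refine ⟨B + B', fun l => ?_⟩
        rw [WithLp.toLp_add, map_add]
        exact (norm_add_le _ _).trans (add_le_add (hB l) (hB' l))
      smul_mem' := by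
        rintro c y ⟨B, hB⟩
        refine ⟨‖c‖ * B, fun l => ?_⟩
        rw [WithLp.toLp_smul, map_smul, norm_smul]
        exact mul_le_mul_of_nonneg_left (hB l) (norm_nonneg _) }
  have hW : W = ⊤ := by
    rw [← top_le_iff, ← span_range_veroneseVec, Submodule.span_le]
    rintro _ ⟨x, rfl⟩
    refine ⟨(C * ‖WithLp.toLp 2 x‖) ^ d, fun l => ?_⟩
    have h1 : g l (WithLp.toLp 2 (veroneseVec d x)) =
        ((r ^ d) ^ l.1.length)⁻¹ • WithLp.toLp 2 (veroneseVec d (S.wordProd l.1 *ᵥ x)) := by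
      rw [← lift_wordProd_mulVec]
      rfl
    rw [h1, norm_smul, norm_toLp_veroneseVec, Real.norm_of_nonneg (by positivity),
      inv_mul_le_iff₀ (by positivity), ← pow_mul, mul_comm d, pow_mul, ← mul_pow]
    refine pow_le_pow_left₀ (norm_nonneg _) ?_ d
    calc ‖WithLp.toLp 2 (S.wordProd l.1 *ᵥ x)‖ ≤ S.wordNorm l.1 * ‖WithLp.toLp 2 x‖ :=
          S.norm_wordProd_mulVec_le _ _
      _ ≤ C * r ^ l.1.length * ‖WithLp.toLp 2 x‖ := by
          gcongr
          exact h _ l.2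
      _ = _ := by ring
  obtain ⟨C', hC'⟩ := banach_steinhaus (g := g) fun y => by
    have hy : y.ofLp ∈ W := hW ▸ Submodule.mem_top
    exact hy
  refine ⟨max C' 1, by positivity, fun l hl => ?_⟩
  have h2 := (hC' ⟨l, lift_accepts.1 hl⟩).trans (le_max_left C' 1)
  simp only [g] at h2
  rw [norm_smul, Real.norm_of_nonneg (by positivity), inv_mul_le_iff₀ (by positivity),
    mul_comm] at h2
  exact h2

theorem lift_cjsr [Finite Λ] (S : SwitchingSystem (Fin n) V Λ) {d : ℕ} (hd : d ≠ 0) :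
    (S.lift d).cjsr = S.cjsr ^ d := by
  refine le_antisymm ?_ ?_
  · have hlim : Tendsto (fun r : ℝ => r ^ d) (𝓝[>] S.cjsr) (𝓝 (S.cjsr ^ d)) :=
      ((continuous_pow d).tendsto _).mono_left nhdsWithin_le_nhds
    refine ge_of_tendsto hlim ?_
    filter_upwards [self_mem_nhdsWithin] with r (hr : S.cjsr < r)
    have hr0 := S.cjsr_nonneg.trans_lt hr
    obtain ⟨C, hC, h⟩ := exists_wordNorm_le_of_cjsr_lt hr
    obtain ⟨C', hC', h'⟩ := exists_lift_wordNorm_le hr0 h d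
    exact cjsr_le_of_wordNorm_le hC' (by positivity) h'
  · refine le_of_forall_gt_imp_ge_of_dense fun r hr => ?_
    have hr0 := (S.lift d).cjsr_nonneg.trans_lt hr
    obtain ⟨C, hC, h⟩ := exists_wordNorm_le_of_cjsr_lt hr
    set q := r ^ ((d : ℝ)⁻¹) with hq
    have hqd : q ^ d = r := Real.rpow_inv_natCast_pow hr0.le hd
    have hq0 : 0 ≤ q := by positivity
    rw [← hqd]
    refine pow_le_pow_left₀ S.cjsr_nonneg ?_ d
    refine cjsr_le_of_wordNorm_le (C := max C 1) (by positivity) hq0 fun l hl => ?_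
    rw [← pow_le_pow_iff_left₀ (S.wordNorm_nonneg l) (by positivity) hd]
    calc S.wordNorm l ^ d ≤ (S.lift d).wordNorm l := S.wordNorm_pow_le_lift hd l
      _ ≤ C * r ^ l.length := h l (lift_accepts.2 hl)
      _ ≤ max C 1 ^ d * r ^ l.length := by
          gcongr
          exact (le_max_left C 1).trans (le_self_pow₀ (le_max_right C 1) hd)
      _ = (max C 1 * q ^ l.length) ^ d := by rw [← hqd]; ring

theorem lmiValue_nonneg {ι : Type*} [Fintype ι] [DecidableEq ι] (S : SwitchingSystem ι V Λ) :
    0 ≤ S.lmiValue :=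
  Real.sInf_nonneg fun _ h => h.1

theorem cjsr_le_lift_lmiValue_rpow [Finite V] [Finite Λ] (S : SwitchingSystem (Fin n) V Λ)
    {d : ℕ} (hd : d ≠ 0) : S.cjsr ≤ (S.lift d).lmiValue ^ (1 / (d : ℝ)) := by
  have h := (S.lift d).cjsr_le_lmiValue
  rw [lift_cjsr S hd] at h
  rw [one_div, Real.le_rpow_inv_iff_of_pos S.cjsr_nonneg (S.lift d).lmiValue_nonneg
    (by positivity), Real.rpow_natCast]
  exact h

theorem lift_lmiValue_rpow_le [Finite Λ] (S : SwitchingSystem (Fin n) V Λ)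
    {d : ℕ} (hd : d ≠ 0) :
    (S.lift d).lmiValue ^ (1 / (d : ℝ)) ≤
      ((n + d - 1).choose d : ℝ) ^ (1 / (2 * (d : ℝ))) * S.cjsr := by
  have h := (S.lift d).lmiValue_le_sqrt_card_mul_cjsr
  rw [lift_cjsr S hd, Sym.card_sym_eq_choose, Fintype.card_fin] at h
  refine (Real.rpow_le_rpow (S.lift d).lmiValue_nonneg h (by positivity)).trans_eq ?_
  rw [Real.mul_rpow (Real.sqrt_nonneg _) (pow_nonneg S.cjsr_nonneg d), one_div,
    Real.pow_rpow_inv_natCast S.cjsr_nonneg hd, Real.sqrt_eq_rpow,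
    ← Real.rpow_mul (Nat.cast_nonneg _)]
  congr 2
  field_simp

end SwitchingSystem

/-! ### The dimension factor -/

theorem choose_le_add_pow (n : ℕ) {d : ℕ} (hd : d ≠ 0) :
    (n + d - 1).choose d ≤ (n + d) ^ n := by
  cases n with
  | zero =>
    rw [Nat.choose_eq_zero_of_lt (by omega)]
    exact Nat.zero_le _
  | succ k =>
    calc (k + 1 + d - 1).choose d = (k + d).choose k := by
          rw [show k + 1 + d - 1 = k + d by omega, Nat.choose_symm_add]
      _ ≤ (k + d) ^ k := Nat.choose_le_pow _ _
      _ ≤ (k + 1 + d) ^ k := Nat.pow_le_pow_left (by omega) k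
      _ ≤ (k + 1 + d) ^ (k + 1) := Nat.pow_le_pow_right (by omega) (Nat.le_succ k)

theorem eventually_choose_rpow_le (n : ℕ) {r : ℝ} (hr : 0 < r) :
    ∀ᶠ d : ℕ in atTop, ((n + d - 1).choose d : ℝ) ^ (1 / (2 * (d : ℝ))) ≤ 1 + r := by
  have hr1 : (1 : ℝ) < 1 + r := by linarith
  have hlim := (tendsto_pow_const_div_const_pow_of_one_lt n hr1).comp (tendsto_add_atTop_nat n)
  have hc : 0 < ((1 + r) ^ n)⁻¹ := by positivity
  filter_upwards [hlim.eventually (gt_mem_nhds hc), eventually_ne_atTop 0] with d hd hd0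
  have h1 : ((n + d - 1).choose d : ℝ) ≤ (1 + r) ^ (2 * d) := by
    calc ((n + d - 1).choose d : ℝ) ≤ ((d + n : ℕ) : ℝ) ^ n := by
          rw [add_comm d n]
          exact_mod_cast choose_le_add_pow n hd0
      _ ≤ ((1 + r) ^ n)⁻¹ * (1 + r) ^ (d + n) := (div_le_iff₀ (by positivity)).1 hd.le
      _ = (1 + r) ^ d := by rw [pow_add]; field_simp
      _ ≤ (1 + r) ^ (2 * d) := pow_le_pow_right₀ hr1.le (by omega)
  have h2 := Real.rpow_le_rpow (Nat.cast_nonneg _) h1 (by positivity : 0 ≤ 1 / (2 * (d : ℝ)))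
  refine h2.trans_eq ?_
  rw [one_div, show (2 * (d : ℝ)) = ((2 * d : ℕ) : ℝ) by push_cast; rfl,
    Real.pow_rpow_inv_natCast (by positivity) (by omega)]

theorem mainTheorem6 (n : ℕ) :
    (∀ (V : Type u) (Λ : Type v) [Finite V] [Finite Λ] (S : SwitchingSystem (Fin n) V Λ),
      S.StronglyConnected →
        Tendsto S.growth atTop (𝓝 S.cjsr) ∧
        ∀ d : ℕ, 1 ≤ d →
          S.cjsr ≤ (S.lift d).lmiValue ^ (1 / (d : ℝ)) ∧
          (S.lift d).lmiValue ^ (1 / (d : ℝ)) ≤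
            ((n + d - 1).choose d : ℝ) ^ (1 / (2 * (d : ℝ))) * S.cjsr) ∧
    (∀ r : ℝ, 0 < r → ∃ d₀ : ℕ, ∀ d : ℕ, d₀ ≤ d →
      ∀ (V : Type u) (Λ : Type v) [Finite V] [Finite Λ] (S : SwitchingSystem (Fin n) V Λ),
        S.StronglyConnected →
          S.cjsr ≤ (S.lift d).lmiValue ^ (1 / (d : ℝ)) ∧
          (S.lift d).lmiValue ^ (1 / (d : ℝ)) ≤ (1 + r) * S.cjsr) := by
  have bounds : ∀ (V : Type u) (Λ : Type v) [Finite V] [Finite Λ]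
      (S : SwitchingSystem (Fin n) V Λ) (d : ℕ), d ≠ 0 →
      S.cjsr ≤ (S.lift d).lmiValue ^ (1 / (d : ℝ)) ∧
      (S.lift d).lmiValue ^ (1 / (d : ℝ)) ≤
        ((n + d - 1).choose d : ℝ) ^ (1 / (2 * (d : ℝ))) * S.cjsr :=
    fun V Λ _ _ S d hd => ⟨S.cjsr_le_lift_lmiValue_rpow hd, S.lift_lmiValue_rpow_le hd⟩
  refine ⟨fun V Λ _ _ S _ => ⟨S.tendsto_growth, fun d hd =>
    bounds V Λ S d (Nat.one_le_iff_ne_zero.1 hd)⟩, fun r hr => ?_⟩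
  obtain ⟨d₀, hd₀⟩ :=
    eventually_atTop.1 ((eventually_choose_rpow_le n hr).and (eventually_ne_atTop 0))
  refine ⟨d₀, fun d hd V Λ _ _ S _ => ?_⟩
  obtain ⟨hchoose, hne⟩ := hd₀ d hd
  obtain ⟨hl, hu⟩ := bounds V Λ S d hne
  exact ⟨hl, hu.trans (mul_le_mul_of_nonneg_right hchoose S.cjsr_nonneg)⟩
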